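/- For $\delta\in\mathbb{C}$ let $T_\delta:\hat{\mathbb C}\to\hat{\mathbb C}$ be the damped Traub map of $p_3(z)=z^3-1$, i.e. the rational map $$T_\delta(z)=N(z)-\delta\,\frac{p_3(N(z))}{p_3'(z)}=\frac{(54-8\delta)z^9+(27+15\delta)z^6-6\delta z^3-\delta}{81z^8},\qquad N(z)=z-\frac{p_3(z)}{p_3'(z)}.$$ For a fixed point $\alpha$ of $T_\delta$ let $\mathcal A_\delta(\alpha)=\{z\in\hat{\mathbb C}: T_\delta^n(z)\to\alpha\}$ and let $\mathcal A^*_\delta(\alpha)$ be the connected component of $\mathcal A_\delta(\alpha)$ that contains $\alpha$. For $\delta\in\mathbb C\setminus\{0,27/4\}$ the free critical points of $T_\delta$ are the points $$c_{\xi,\pm}=\xi\sqrt[3]{r_\pm},\qquad r_\pm=\frac{19\delta\pm\sqrt{27(16\delta+11\delta^2)}}{54-8\delta},\qquad \xi^3=1,$$ where for $\delta\in(0,1]$ the square root is the nonnegative one and the cube root is the real one; for complex $\delta$ the set of these points does not depend on the choice of the roots. Call $\delta\in\mathbb C\setminus\{0,27/4\}$ hyperbolic if every free critical point of $T_\delta$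 lies in the basin of attraction of some attracting cycle of $T_\delta$. A hyperbolic component is a connected component of the set of hyperbolic parameters that is open in $\mathbb{C}$. **Proposition.** (1) For every $\delta\in(0,1]$ and every $\xi$ with $\xi^3=1$ we have $c_{\xi,+}\in\mathcal A^*_\delta(\xi)$ and $T_\delta(c_{\xi,-})\in\mathcal A^*_\delta(\xi)$. (2) There is a hyperbolic component $U$ with $(0,1]\subset U$ such that for every $\delta\in U$ each free critical point of $T_\delta$ lies in $\mathcal A_\delta(\xi)$ for some $\xi$ with $\xi^3=1$. -/

import Mathlib

open Topology Filter

/-! ### Topological dynamics of a self-map -/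

/-- The basin of attraction of the point `α` under iteration of `f`. -/
def basin {X : Type*} [TopologicalSpace X] (f : X → X) (α : X) : Set X :=
  {x | Tendsto (fun n : ℕ => f^[n] x) atTop (𝓝 α)}

/-- The immediate basin of attraction of a fixed point `α` of `f`: the connected component of the
basin that contains `α`. -/
def immediateBasin {X : Type*} [TopologicalSpace X] (f : X → X) (α : X) : Set X :=
  connectedComponentIn (basin f α) α

/-! ### Multipliers and attracting cycles on the Riemann sphere `OnePoint ℂ = ℂ ∪ {∞}` -/

/-- The involution `z ↦ 1/z` of the Riemann sphere. -/
noncomputable def sphereInv : OnePoint ℂ → OnePoint ℂ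
  | OnePoint.infty => ((0 : ℂ) : OnePoint ℂ)
  | OnePoint.some z => if z = 0 then OnePoint.infty else ((z⁻¹ : ℂ) : OnePoint ℂ)

/-- The affine coordinate of a finite point of the sphere (with the dummy value `0` at `∞`). -/
def affineCoord : OnePoint ℂ → ℂ
  | OnePoint.infty => 0
  | OnePoint.some z => z

/-- The fixed point `p` of a map `g` of the sphere, holomorphic at `p`, has multiplier `l`: `l` is
the derivative of `g` at `p` in the coordinate `z` if `p` is finite, and the derivative at `0` of
`w ↦ 1 / g (1 / w)` if `p = ∞`. -/
def HasMultiplier (g : OnePoint ℂ → OnePoint ℂ) (p : OnePoint ℂ) (l : ℂ) : Prop :=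
  match p with
  | OnePoint.some z => HasDerivAt (fun w : ℂ => affineCoord (g (w : OnePoint ℂ))) l z
  | OnePoint.infty =>
      HasDerivAt (fun w : ℂ => affineCoord (sphereInv (g (sphereInv (w : OnePoint ℂ))))) l 0

/-- `f^n` (with `n ≥ 1`) fixes `p`, with a multiplier of modulus less than one. -/
def IsAttractingPeriodicPt (f : OnePoint ℂ → OnePoint ℂ) (n : ℕ) (p : OnePoint ℂ) : Prop :=
  0 < n ∧ f^[n] p = p ∧ ∃ l : ℂ, HasMultiplier (f^[n]) p l ∧ ‖l‖ < 1

/-! ### Newton's method and the damped Traub method -/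

/-- Newton's map `N_p(z) = z - p(z) / p'(z)`, at points with `p'(z) ≠ 0`. -/
noncomputable def newtonMap (p : Polynomial ℂ) (z : ℂ) : ℂ :=
  z - p.eval z / p.derivative.eval z

/-- The damped Traub map `T_{p,δ}(z) = N_p(z) - δ p(N_p(z)) / p'(z)`, at points with
`p'(z) ≠ 0`. -/
noncomputable def dampedTraub (p : Polynomial ℂ) (δ z : ℂ) : ℂ :=
  newtonMap p z - δ * (p.eval (newtonMap p z) / p.derivative.eval z)

/-- The polynomial `p_3(z) = z^3 - 1`. -/
noncomputable def cubicPoly : Polynomial ℂ := Polynomial.X ^ 3 - 1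

/-- The damped Traub map of `p_3` as a rational self-map of the Riemann sphere
`OnePoint ℂ = ℂ ∪ {∞}`. The only finite pole is the zero `0` of `p_3'`. As
`T(z) = ((54 - 8δ) z^9 + (27 + 15δ) z^6 - 6δ z^3 - δ) / (81 z^8)`, the point `∞` is fixed unless
`δ = 27/4`, in which case it is sent to `0`. -/
noncomputable def cubicTraub (δ : ℂ) : OnePoint ℂ → OnePoint ℂ
  | OnePoint.infty => if δ = 27 / 4 then ((0 : ℂ) : OnePoint ℂ) else OnePoint.infty
  | OnePoint.some z =>
      if z = 0 then OnePoint.infty else ((dampedTraub cubicPoly δ z : ℂ) : OnePoint ℂ)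

/-! ### Free critical points -/

/-- The real cube root of a real number. -/
noncomputable def realCbrt (x : ℝ) : ℝ := Real.sign x * |x| ^ (1 / 3 : ℝ)

noncomputable def rPlus (δ : ℝ) : ℝ :=
  (19 * δ + Real.sqrt (27 * (16 * δ + 11 * δ ^ 2))) / (54 - 8 * δ)

noncomputable def rMinus (δ : ℝ) : ℝ :=
  (19 * δ - Real.sqrt (27 * (16 * δ + 11 * δ ^ 2))) / (54 - 8 * δ)

/-- The free critical point `c_{ξ,+}` for a real parameter `δ`. -/
noncomputable def cPlus (δ : ℝ) (ξ : ℂ) : ℂ := ξ * (realCbrt (rPlus δ) : ℂ)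

/-- The free critical point `c_{ξ,-}` for a real parameter `δ`. -/
noncomputable def cMinus (δ : ℝ) (ξ : ℂ) : ℂ := ξ * (realCbrt (rMinus δ) : ℂ)

/-- The free critical points for a complex parameter `δ ≠ 27/4`: all cube roots of the two numbers
`(19δ ± √(27(16δ + 11δ²))) / (54 - 8δ)`, both square roots being allowed for `s`. -/
def IsFreeCriticalPt (δ c : ℂ) : Prop :=
  ∃ s : ℂ, s ^ 2 = 27 * (16 * δ + 11 * δ ^ 2) ∧ c ^ 3 = (19 * δ + s) / (54 - 8 * δ)

/-! ### The parameter plane -/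

/-- The hyperbolic parameters of the family: those `δ ∉ {0, 27/4}` (so that `T` has degree nine) for
which every free critical point is attracted to an attracting cycle. -/
def hyperbolicParameters : Set ℂ :=
  {δ | δ ≠ 0 ∧ δ ≠ 27 / 4 ∧ ∀ c : ℂ, IsFreeCriticalPt δ c →
    ∃ (n : ℕ) (p : OnePoint ℂ), IsAttractingPeriodicPt (cubicTraub δ) n p ∧
      (c : OnePoint ℂ) ∈ basin ((cubicTraub δ)^[n]) p}

/-- A hyperbolic component: an open subset of the parameter plane that is a connected component of
the set of hyperbolic parameters. -/
def IsHyperbolicComponent (U : Set ℂ) : Prop :=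
  IsOpen U ∧ ∃ δ ∈ hyperbolicParameters, U = connectedComponentIn hyperbolicParameters δ

/-! ### The Traub map in coordinates -/

/-! Since T_δ(ξz) = ξ T_δ(z) for ξ^3 = 1, each ray through a cube root of unity reduces to one real
map fixing 1. For 0 < δ ≤ 1 this map contracts [1, ∞) towards 1 and sends [∛r_+, 1] into [1, ∞). So
ξ·[∛r_+, ∞) is a connected subset of the basin through ξ that contains c_{ξ,+}. The real map also
sends ∛r_- to a value at least 1, so T_δ(c_{ξ,-}) lies on the same ray
(`mul_ofReal_mem_immediateBasin`, `one_le_realTraub_neg`).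

For (2), let B be the set `rootParameters`. It contains (0,1] and is open, because the roots are
superattracting uniformly in δ and the free critical points stay bounded. It is also closed relative
to the hyperbolic set: a cycle away from the roots that attracted a free critical point would have a
trapping neighbourhood that survives perturbation, against nearby parameters in B. A connected set
of hyperbolic parameters meeting B therefore lies in B. -/

theorem dampedTraub_cubicPoly (δ : ℂ) {z : ℂ} (hz : z ≠ 0) :
    dampedTraub cubicPoly δ z =
      ((54 - 8 * δ) * z ^ 9 + (27 + 15 * δ) * z ^ 6 - 6 * δ * z ^ 3 - δ) / (81 * z ^ 8) := by
  simp only [dampedTraub, newtonMap, cubicPoly, Polynomial.eval_sub, Polynomial.eval_pow,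
    Polynomial.eval_X, Polynomial.eval_one, Polynomial.derivative_sub,
    Polynomial.derivative_X_pow, Polynomial.derivative_one, sub_zero, Polynomial.eval_mul,
    Polynomial.eval_C]
  push_cast
  field_simp
  ring

theorem cubicTraub_coe (δ : ℂ) {z : ℂ} (hz : z ≠ 0) :
    cubicTraub δ (z : OnePoint ℂ) =
      (((((54 - 8 * δ) * z ^ 9 + (27 + 15 * δ) * z ^ 6 - 6 * δ * z ^ 3 - δ) / (81 * z ^ 8) : ℂ)) :
        OnePoint ℂ) := by
  rw [← dampedTraub_cubicPoly δ hz]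
  exact if_neg hz

theorem cubicTraub_zero (δ : ℂ) : cubicTraub δ ((0 : ℂ) : OnePoint ℂ) = OnePoint.infty :=
  if_pos rfl

theorem cubicTraub_infty {δ : ℂ} (hδ : δ ≠ 27 / 4) :
    cubicTraub δ OnePoint.infty = OnePoint.infty :=
  if_neg hδ

theorem sphereInv_infty : sphereInv OnePoint.infty = ((0 : ℂ) : OnePoint ℂ) := rfl

theorem sphereInv_zero : sphereInv ((0 : ℂ) : OnePoint ℂ) = OnePoint.infty := if_pos rfl

theorem sphereInv_coe {z : ℂ} (hz : z ≠ 0) :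
    sphereInv (z : OnePoint ℂ) = ((z⁻¹ : ℂ) : OnePoint ℂ) := if_neg hz

theorem sphereInv_sphereInv (x : OnePoint ℂ) : sphereInv (sphereInv x) = x := by
  induction x using OnePoint.rec with
  | infty => rw [sphereInv_infty, sphereInv_zero]
  | coe z =>
    by_cases hz : z = 0
    · subst hz; rw [sphereInv_zero, sphereInv_infty]
    · rw [sphereInv_coe hz, sphereInv_coe (inv_ne_zero hz), inv_inv]

theorem continuous_sphereInv : Continuous sphereInv := by
  rw [continuous_iff_continuousAt]
  intro x
  induction x using OnePoint.rec with
  | infty =>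
    rw [OnePoint.continuousAt_infty', sphereInv_infty, Filter.coclosedCompact_eq_cocompact,
      ← Metric.cobounded_eq_cocompact]
    have h : Tendsto (fun z : ℂ => ((z⁻¹ : ℂ) : OnePoint ℂ)) (Bornology.cobounded ℂ)
        (𝓝 ((0 : ℂ) : OnePoint ℂ)) :=
      (OnePoint.continuous_coe.tendsto 0).comp tendsto_inv₀_cobounded
    refine h.congr' ?_
    filter_upwards [Bornology.eventually_ne_cobounded (0 : ℂ)] with z hz
    exact (sphereInv_coe hz).symm
  | coe z =>
    rw [OnePoint.continuousAt_coe]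
    by_cases hz : z = 0
    · subst hz
      rw [continuousAt_iff_punctured_nhds]
      change Tendsto _ _ (𝓝 (sphereInv ((0 : ℂ) : OnePoint ℂ)))
      rw [sphereInv_zero]
      have h : Tendsto (fun z : ℂ => ((z⁻¹ : ℂ) : OnePoint ℂ)) (𝓝[≠] 0) (𝓝 OnePoint.infty) := by
        have h1 := OnePoint.tendsto_coe_infty (X := ℂ)
        rw [Filter.coclosedCompact_eq_cocompact, ← Metric.cobounded_eq_cocompact] at h1
        exact h1.comp tendsto_inv₀_nhdsNE_zero
      refine h.congr' ?_
      filter_upwards [self_mem_nhdsWithin] with z hz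
      exact (sphereInv_coe hz).symm
    · have h : ContinuousAt (fun z : ℂ => ((z⁻¹ : ℂ) : OnePoint ℂ)) z :=
        OnePoint.continuous_coe.continuousAt.comp (continuousAt_inv₀ hz)
      refine h.congr ?_
      filter_upwards [eventually_ne_nhds hz] with w hw
      exact (sphereInv_coe hw).symm

theorem sphereInv_coe_div {a b : ℂ} (hb : b ≠ 0) (ha : a ≠ 0) :
    sphereInv ((a / b : ℂ) : OnePoint ℂ) = ((b / a : ℂ) : OnePoint ℂ) := by
  rw [sphereInv_coe (div_ne_zero ha hb), inv_div]

/-! ### Joint continuity in the parameter and the variable -/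

theorem continuousAt_prod_coe_iff {Y : Type*} [TopologicalSpace Y] {F : ℂ × OnePoint ℂ → Y}
    {δ z : ℂ} : ContinuousAt F (δ, (z : OnePoint ℂ)) ↔
      ContinuousAt (fun q : ℂ × ℂ => F (q.1, (q.2 : OnePoint ℂ))) (δ, z) :=
  ((Topology.IsOpenEmbedding.id.prodMap OnePoint.isOpenEmbedding_coe).continuousAt_iff
    (g := F) (x := (δ, z))).symm

/-- The two excluded values are where joint continuity fails: the numerator at z = 0 is -δ, and the
leading coefficient 54 - 8δ governs the behaviour at ∞. Near 0 and ∞ the reciprocal 1/T is a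
quotient with nonvanishing denominator. -/
theorem continuousAt_cubicTraub {δ₀ : ℂ} (h0 : δ₀ ≠ 0) (h1 : δ₀ ≠ 27 / 4) (x : OnePoint ℂ) :
    ContinuousAt (fun q : ℂ × OnePoint ℂ => cubicTraub q.1 q.2) (δ₀, x) := by
  induction x using OnePoint.rec with
  | coe z =>
    rw [continuousAt_prod_coe_iff]
    by_cases hz : z = 0
    · subst hz
      have hnum : ContinuousAt (fun q : ℂ × ℂ => (54 - 8 * q.1) * q.2 ^ 9
          + (27 + 15 * q.1) * q.2 ^ 6 - 6 * q.1 * q.2 ^ 3 - q.1) (δ₀, 0) := by fun_prop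
      have hne : (fun q : ℂ × ℂ => (54 - 8 * q.1) * q.2 ^ 9
          + (27 + 15 * q.1) * q.2 ^ 6 - 6 * q.1 * q.2 ^ 3 - q.1) (δ₀, 0) ≠ 0 := by simpa using h0
      have hc : ContinuousAt (fun q : ℂ × ℂ => sphereInv ((81 * q.2 ^ 8 /
          ((54 - 8 * q.1) * q.2 ^ 9 + (27 + 15 * q.1) * q.2 ^ 6 - 6 * q.1 * q.2 ^ 3 - q.1) : ℂ) :
            OnePoint ℂ)) (δ₀, 0) := by
        refine continuous_sphereInv.continuousAt.comp
          (OnePoint.continuous_coe.continuousAt.comp (ContinuousAt.div ?_ hnum hne))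
        fun_prop
      refine hc.congr ?_
      filter_upwards [hnum.eventually_ne hne] with q hq
      by_cases hz : q.2 = 0
      · simp only [hz, cubicTraub_zero]
        simp [sphereInv_zero]
      · simp only [cubicTraub_coe _ hz]
        exact sphereInv_coe_div hq (by simpa using hz)
    · have hc : ContinuousAt (fun q : ℂ × ℂ => ((((54 - 8 * q.1) * q.2 ^ 9
          + (27 + 15 * q.1) * q.2 ^ 6 - 6 * q.1 * q.2 ^ 3 - q.1) / (81 * q.2 ^ 8) : ℂ) :
            OnePoint ℂ)) (δ₀, z) := by
        refine OnePoint.continuous_coe.continuousAt.comp (ContinuousAt.div ?_ ?_ ?_)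
        · fun_prop
        · fun_prop
        · simpa using hz
      refine hc.congr ?_
      have : ContinuousAt (fun q : ℂ × ℂ => q.2) (δ₀, z) := continuousAt_snd
      filter_upwards [this.eventually_ne hz] with q hq
      exact (cubicTraub_coe _ hq).symm
  | infty =>
    suffices h : ContinuousAt (fun q : ℂ × OnePoint ℂ => cubicTraub q.1 (sphereInv q.2))
        (δ₀, ((0 : ℂ) : OnePoint ℂ)) by
      have hi : ContinuousAt (fun q : ℂ × OnePoint ℂ => (q.1, sphereInv q.2))
          (δ₀, OnePoint.infty) :=
        continuousAt_fst.prodMk (continuous_sphereInv.continuousAt.comp continuousAt_snd)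
      have := ContinuousAt.comp (x := (δ₀, (OnePoint.infty : OnePoint ℂ))) (f := fun q : ℂ × OnePoint ℂ => (q.1, sphereInv q.2))
        (g := fun q : ℂ × OnePoint ℂ => cubicTraub q.1 (sphereInv q.2)) h hi
      simpa only [Function.comp_def, sphereInv_sphereInv] using this
    rw [continuousAt_prod_coe_iff]
    have hden : ContinuousAt (fun q : ℂ × ℂ => (54 - 8 * q.1)
        + (27 + 15 * q.1) * q.2 ^ 3 - 6 * q.1 * q.2 ^ 6 - q.1 * q.2 ^ 9) (δ₀, 0) := by fun_prop
    have hne : (fun q : ℂ × ℂ => (54 - 8 * q.1)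
        + (27 + 15 * q.1) * q.2 ^ 3 - 6 * q.1 * q.2 ^ 6 - q.1 * q.2 ^ 9) (δ₀, 0) ≠ 0 := by
      simp only [ne_eq, OfNat.ofNat_ne_zero, not_false_eq_true, zero_pow, mul_zero, add_zero,
        sub_zero]
      intro h
      apply h1
      linear_combination (-1 / 8 : ℂ) * h
    have hc : ContinuousAt (fun q : ℂ × ℂ => sphereInv ((81 * q.2 /
        ((54 - 8 * q.1) + (27 + 15 * q.1) * q.2 ^ 3 - 6 * q.1 * q.2 ^ 6 - q.1 * q.2 ^ 9) : ℂ) :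
          OnePoint ℂ)) (δ₀, 0) := by
      refine continuous_sphereInv.continuousAt.comp
        (OnePoint.continuous_coe.continuousAt.comp (ContinuousAt.div ?_ hden hne))
      fun_prop
    refine hc.congr ?_
    have h27 : ContinuousAt (fun q : ℂ × ℂ => q.1) (δ₀, 0) := continuousAt_fst
    filter_upwards [hden.eventually_ne hne, h27.eventually_ne h1] with q hq hq1
    by_cases hz : q.2 = 0
    · simp only [hz, sphereInv_zero, cubicTraub_infty hq1]
      simp [sphereInv_zero]
    · simp only [sphereInv_coe hz, cubicTraub_coe _ (inv_ne_zero hz)]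
      rw [sphereInv_coe_div hq (by simpa using hz)]
      congr 1
      field_simp

theorem continuousAt_iterate_cubicTraub {δ₀ : ℂ} (h0 : δ₀ ≠ 0) (h1 : δ₀ ≠ 27 / 4) (n : ℕ)
    (x : OnePoint ℂ) :
    ContinuousAt (fun q : ℂ × OnePoint ℂ => (cubicTraub q.1)^[n] q.2) (δ₀, x) := by
  induction n with
  | zero => exact continuousAt_snd
  | succ n ih =>
    simp only [Function.iterate_succ_apply']
    exact ContinuousAt.comp (x := (δ₀, x))
      (f := fun q : ℂ × OnePoint ℂ => (q.1, (cubicTraub q.1)^[n] q.2))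
      (g := fun q : ℂ × OnePoint ℂ => cubicTraub q.1 q.2)
      (continuousAt_cubicTraub h0 h1 _) (continuousAt_fst.prodMk ih)

/-! ### Trapping neighbourhoods of attracting periodic points -/

/-- A continuous family of maps of the sphere whose member at `δ₀` has an attracting fixed point
`p ∈ ℂ` maps some small closed disc around `p` into itself for all parameters near `δ₀`. -/
theorem exists_trapping_disc {G : ℂ × OnePoint ℂ → OnePoint ℂ} {δ₀ p l : ℂ}
    (hG : ∀ x, ContinuousAt G (δ₀, x)) (hp : G (δ₀, (p : OnePoint ℂ)) = p)
    (hd : HasMultiplier (fun x => G (δ₀, x)) (p : OnePoint ℂ) l) (hl : ‖l‖ < 1)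
    {W : Set (OnePoint ℂ)} (hW : W ∈ 𝓝 (p : OnePoint ℂ)) :
    ∃ D ∈ 𝓝 (p : OnePoint ℂ), IsClosed D ∧ D ⊆ W ∧
      ∀ᶠ δ in 𝓝 δ₀, ∀ x ∈ D, G (δ, x) ∈ D := by
  obtain ⟨k, hlk, hk⟩ := exists_between hl
  have hd' : HasDerivAt (fun w : ℂ => affineCoord (G (δ₀, (w : OnePoint ℂ)))) l p := hd
  have hpc : affineCoord (G (δ₀, (p : OnePoint ℂ))) = p := by rw [hp]; rfl
  have hcontr : ∀ᶠ w : ℂ in 𝓝 p, ‖affineCoord (G (δ₀, (w : OnePoint ℂ))) - p‖ ≤ k * ‖w - p‖ := by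
    have := hd'.isLittleO.def (sub_pos.2 hlk)
    filter_upwards [this] with w hw
    rw [hpc, smul_eq_mul] at hw
    calc _ = ‖(affineCoord (G (δ₀, (w : OnePoint ℂ))) - p - (w - p) * l) + (w - p) * l‖ := by
            congr 1; ring
      _ ≤ _ := norm_add_le _ _
      _ ≤ (k - ‖l‖) * ‖w - p‖ + ‖w - p‖ * ‖l‖ := by rw [norm_mul]; gcongr
      _ = _ := by ring
  have hfin : ∀ᶠ w : ℂ in 𝓝 p, G (δ₀, (w : OnePoint ℂ)) ≠ OnePoint.infty := by
    have hc : ContinuousAt (fun w : ℂ => G (δ₀, (w : OnePoint ℂ))) p :=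
      (hG p).comp (f := fun w : ℂ => (δ₀, (w : OnePoint ℂ)))
        (continuousAt_const.prodMk OnePoint.continuous_coe.continuousAt)
    exact hc.eventually_ne (by rw [hp]; exact OnePoint.coe_ne_infty p)
  have hW' : ∀ᶠ w : ℂ in 𝓝 p, (w : OnePoint ℂ) ∈ W :=
    OnePoint.continuous_coe.continuousAt.eventually hW
  obtain ⟨r, hr, hball⟩ := Metric.nhds_basis_closedBall.eventually_iff.1
    (hcontr.and (hfin.and hW'))
  have hcpt : IsCompact ((fun z : ℂ => (z : OnePoint ℂ)) '' Metric.closedBall p r) :=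
    (isCompact_closedBall p r).image OnePoint.continuous_coe
  have hopen : IsOpen ((fun z : ℂ => (z : OnePoint ℂ)) '' Metric.ball p r) :=
    OnePoint.isOpenEmbedding_coe.isOpenMap _ Metric.isOpen_ball
  refine ⟨_, OnePoint.isOpenEmbedding_coe.isOpenMap.image_mem_nhds
    (Metric.closedBall_mem_nhds p hr), hcpt.isClosed, ?_, ?_⟩
  · rintro _ ⟨w, hw, rfl⟩
    exact (hball hw).2.2
  · have key : ∀ x ∈ (fun z : ℂ => (z : OnePoint ℂ)) '' Metric.closedBall p r,
        ∀ᶠ q : ℂ × OnePoint ℂ in 𝓝 (δ₀, x),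
          G q ∈ (fun z : ℂ => (z : OnePoint ℂ)) '' Metric.ball p r := by
      rintro _ ⟨w, hw, rfl⟩
      obtain ⟨h1, h2, -⟩ := hball hw
      refine (hG _).eventually (hopen.mem_nhds ?_)
      obtain ⟨v, hv⟩ := OnePoint.ne_infty_iff_exists.1 h2
      refine ⟨v, ?_, hv⟩
      rw [← hv] at h1
      change ‖v - p‖ ≤ _ at h1
      rw [Metric.mem_closedBall, dist_eq_norm] at hw
      rw [Metric.mem_ball, dist_eq_norm]
      have : 0 ≤ ‖l‖ := norm_nonneg l
      nlinarith [norm_nonneg (w - p)]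
    filter_upwards [hcpt.eventually_forall_of_forall_eventually
      (P := fun δ x => G (δ, x) ∈ (fun z : ℂ => (z : OnePoint ℂ)) '' Metric.ball p r) key] with δ hδ x hx
    exact Set.image_mono Metric.ball_subset_closedBall (hδ x hx)

theorem exists_trapping_nhds {G : ℂ × OnePoint ℂ → OnePoint ℂ} {δ₀ l : ℂ} {p : OnePoint ℂ}
    (hG : ∀ x, ContinuousAt G (δ₀, x)) (hp : G (δ₀, p) = p)
    (hd : HasMultiplier (fun x => G (δ₀, x)) p l) (hl : ‖l‖ < 1)
    {W : Set (OnePoint ℂ)} (hW : W ∈ 𝓝 p) :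
    ∃ D ∈ 𝓝 p, IsClosed D ∧ D ⊆ W ∧ ∀ᶠ δ in 𝓝 δ₀, ∀ x ∈ D, G (δ, x) ∈ D := by
  induction p using OnePoint.rec with
  | coe p => exact exists_trapping_disc hG hp hd hl hW
  | infty =>
    -- Conjugation by `sphereInv` moves ∞ to 0; the multiplier at ∞ is by definition that of the
    -- conjugate, so `hd` applies unchanged.
    have hsi : ∀ x, ContinuousAt sphereInv x := fun x => continuous_sphereInv.continuousAt
    obtain ⟨D, hD, hDc, hDW, hev⟩ := exists_trapping_disc
      (G := fun q => sphereInv (G (q.1, sphereInv q.2))) (δ₀ := δ₀) (p := 0) (l := l)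
      (W := sphereInv ⁻¹' W)
      (fun x => (hsi _).comp ((hG _).comp (f := fun q : ℂ × OnePoint ℂ => (q.1, sphereInv q.2))
        (continuousAt_fst.prodMk ((hsi _).comp continuousAt_snd))))
      (by simp only [sphereInv_zero, hp, sphereInv_infty]) hd hl
      ((hsi _).preimage_mem_nhds (by rwa [sphereInv_zero]))
    refine ⟨sphereInv ⁻¹' D, (hsi _).preimage_mem_nhds (by rwa [sphereInv_infty]),
      hDc.preimage continuous_sphereInv, ?_, ?_⟩
    · intro x hx
      have := hDW hx
      rwa [Set.mem_preimage, sphereInv_sphereInv] at this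
    · filter_upwards [hev] with δ hδ x hx
      have := hδ _ hx
      rwa [sphereInv_sphereInv] at this

/-! ### Basins -/

theorem mem_basin_of_iterate_mem {X : Type*} [TopologicalSpace X] {f : X → X} {α x : X} (n : ℕ)
    (h : f^[n] x ∈ basin f α) : x ∈ basin f α := by
  have h' : Tendsto (fun k : ℕ => f^[k] (f^[n] x)) atTop (𝓝 α) := h
  simp only [← Function.iterate_add_apply] at h'
  exact (tendsto_add_atTop_iff_nat (f := fun k => f^[k] x) n).1 h'

/-- An invariant set of finite points on which `f` contracts towards `p` lies in the basin. -/
theorem mem_basin_of_contracting {f : OnePoint ℂ → OnePoint ℂ} {p : ℂ} {S : Set ℂ} {k : ℝ}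
    (hk0 : 0 ≤ k) (hk : k < 1)
    (h : ∀ z ∈ S, ∃ w ∈ S, f (z : OnePoint ℂ) = (w : OnePoint ℂ) ∧ ‖w - p‖ ≤ k * ‖z - p‖)
    {z : ℂ} (hz : z ∈ S) : (z : OnePoint ℂ) ∈ basin f (p : OnePoint ℂ) := by
  have key : ∀ n : ℕ, ∃ w ∈ S, f^[n] (z : OnePoint ℂ) = (w : OnePoint ℂ) ∧
      ‖w - p‖ ≤ k ^ n * ‖z - p‖ := by
    intro n
    induction n with
    | zero => exact ⟨z, hz, rfl, by simp⟩
    | succ n ih =>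
      obtain ⟨w, hw, hfw, hle⟩ := ih
      obtain ⟨v, hv, hfv, hle'⟩ := h w hw
      refine ⟨v, hv, by rw [Function.iterate_succ_apply', hfw, hfv], hle'.trans ?_⟩
      rw [pow_succ', mul_assoc]
      gcongr
  choose w _ hw hle using key
  have hlim : Tendsto w atTop (𝓝 p) := by
    rw [tendsto_iff_norm_sub_tendsto_zero]
    refine squeeze_zero (fun _ => norm_nonneg _) hle ?_
    simpa using (tendsto_pow_atTop_nhds_zero_of_lt_one hk0 hk).mul_const ‖z - p‖
  change Tendsto (fun n => f^[n] (z : OnePoint ℂ)) atTop _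
  simp only [hw]
  exact (OnePoint.continuous_coe.tendsto p).comp hlim

/-! ### Local behaviour at the cube roots of unity -/

/-- The quotient of `T_δ(z) - ξ` by `(z - ξ)^2`. -/
noncomputable def traubQuotient (ξ δ z : ℂ) : ℂ :=
  (2 * z + ξ) / (3 * z ^ 2) *
    (1 - δ * (((2 * z ^ 3 + 1) / (3 * z ^ 2)) ^ 2 + (2 * z ^ 3 + 1) / (3 * z ^ 2) * ξ + ξ ^ 2)
      / (3 * z ^ 2))

/-- With N Newton's map, N - ξ = (z - ξ)^2 (2z + ξ)/(3z^2), and N - ξ divides N^3 - 1 = N^3 - ξ^3.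
Hence every root is superattracting for every δ. -/
theorem cubicTraub_eq_quotient {ξ : ℂ} (hξ : ξ ^ 3 = 1) (δ : ℂ) {z : ℂ} (hz : z ≠ 0) :
    cubicTraub δ (z : OnePoint ℂ) =
      ((ξ + (z - ξ) ^ 2 * traubQuotient ξ δ z : ℂ) : OnePoint ℂ) := by
  rw [cubicTraub_coe δ hz]
  congr 1
  set N := (2 * z ^ 3 + 1) / (3 * z ^ 2) with hN
  have hN' : 3 * z ^ 2 * N = 2 * z ^ 3 + 1 := by rw [hN]; field_simp
  have h1 : (z - ξ) ^ 2 * traubQuotient ξ δ z =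
      (N - ξ) - δ * (N ^ 3 - 1) / (3 * z ^ 2) := by
    have h2 : (z - ξ) ^ 2 * ((2 * z + ξ) / (3 * z ^ 2)) = N - ξ := by
      rw [hN]; field_simp; linear_combination hξ
    rw [traubQuotient, ← hN, ← mul_assoc, h2]
    linear_combination (δ / (3 * z ^ 2)) * hξ
  rw [h1, hN]
  field_simp
  ring

theorem ne_zero_of_cube_eq_one {ξ : ℂ} (hξ : ξ ^ 3 = 1) : ξ ≠ 0 := by
  rintro rfl
  simp at hξ

theorem cubicTraub_root {ξ : ℂ} (hξ : ξ ^ 3 = 1) (δ : ℂ) :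
    cubicTraub δ (ξ : OnePoint ℂ) = (ξ : OnePoint ℂ) := by
  rw [cubicTraub_eq_quotient hξ δ (ne_zero_of_cube_eq_one hξ)]
  simp

theorem hasMultiplier_cubicTraub_root {ξ : ℂ} (hξ : ξ ^ 3 = 1) (δ : ℂ) :
    HasMultiplier (cubicTraub δ) (ξ : OnePoint ℂ) 0 := by
  have h0 := ne_zero_of_cube_eq_one hξ
  change HasDerivAt (fun w : ℂ => affineCoord (cubicTraub δ (w : OnePoint ℂ))) 0 ξ
  have hq : DifferentiableAt ℂ (traubQuotient ξ δ) ξ := by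
    unfold traubQuotient
    fun_prop (disch := simpa using h0)
  have h1 := (((hasDerivAt_id ξ).sub_const ξ).pow 2).mul hq.hasDerivAt
  norm_num at h1
  refine (h1.const_add ξ).congr_of_eventuallyEq ?_
  filter_upwards [eventually_ne_nhds h0] with z hz
  rw [cubicTraub_eq_quotient hξ δ hz]
  rfl

theorem isAttractingPeriodicPt_root {ξ : ℂ} (hξ : ξ ^ 3 = 1) (δ : ℂ) :
    IsAttractingPeriodicPt (cubicTraub δ) 1 (ξ : OnePoint ℂ) :=
  ⟨one_pos, cubicTraub_root hξ δ, 0, hasMultiplier_cubicTraub_root hξ δ, by simp⟩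

theorem eventually_mem_basin_root {ξ : ℂ} (hξ : ξ ^ 3 = 1) (δ₀ : ℂ) :
    ∀ᶠ q : ℂ × OnePoint ℂ in 𝓝 (δ₀, (ξ : OnePoint ℂ)),
      q.2 ∈ basin (cubicTraub q.1) (ξ : OnePoint ℂ) := by
  have h0 := ne_zero_of_cube_eq_one hξ
  have hc : ContinuousAt (fun q : ℂ × ℂ => ‖(q.2 - ξ) * traubQuotient ξ q.1 q.2‖) (δ₀, ξ) := by
    unfold traubQuotient
    fun_prop (disch := simpa using h0)
  -- This factor vanishes at (δ₀, ξ), so on a product ball T_δ halves the distance to ξ.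
  have hlt : ∀ᶠ q : ℂ × ℂ in 𝓝 (δ₀, ξ), ‖(q.2 - ξ) * traubQuotient ξ q.1 q.2‖ < 1 / 2 := by
    refine hc.eventually (gt_mem_nhds ?_)
    simp
  have hne : ∀ᶠ q : ℂ × ℂ in 𝓝 (δ₀, ξ), q.2 ≠ 0 :=
    (continuousAt_snd (p := (δ₀, ξ))).eventually_ne h0
  obtain ⟨r, hr, hball⟩ := Metric.eventually_nhds_iff_ball.1 (hlt.and hne)
  have hfin : ∀ᶠ q : ℂ × ℂ in 𝓝 (δ₀, ξ),
      (q.2 : OnePoint ℂ) ∈ basin (cubicTraub q.1) (ξ : OnePoint ℂ) := by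
    filter_upwards [Metric.ball_mem_nhds _ hr] with q hq
    rw [← ball_prod_same] at hq
    refine mem_basin_of_contracting (S := Metric.ball ξ r) (k := 1 / 2) (by norm_num)
      (by norm_num) ?_ hq.2
    intro z hz
    obtain ⟨h1, h2⟩ := hball (q.1, z) (by rw [← ball_prod_same]; exact ⟨hq.1, hz⟩)
    simp only at h1 h2
    have h3 : ‖ξ + (z - ξ) ^ 2 * traubQuotient ξ q.1 z - ξ‖ ≤ 1 / 2 * ‖z - ξ‖ := by
      rw [add_sub_cancel_left, pow_two, mul_assoc, norm_mul, mul_comm]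
      gcongr
    refine ⟨_, ?_, cubicTraub_eq_quotient hξ q.1 h2, h3⟩
    rw [mem_ball_iff_norm] at hz ⊢
    linarith [norm_nonneg (z - ξ)]
  have hemb := Topology.IsOpenEmbedding.id.prodMap (OnePoint.isOpenEmbedding_coe (X := ℂ)) (f := (id : ℂ → ℂ))
  have hmap := hemb.map_nhds_eq (δ₀, ξ)
  change map _ _ = 𝓝 (δ₀, (ξ : OnePoint ℂ)) at hmap
  rw [← hmap, eventually_map]
  exact hfin

/-! ### Dependence of the free critical points on the parameter -/

/-- The open mapping theorem lets square and cube roots follow the parameter without a choice of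
branch, even at 0. -/
theorem nhds_le_map_pow (n : ℕ) (hn : n ≠ 0) (x : ℂ) :
    𝓝 (x ^ n) ≤ map (fun z : ℂ => z ^ n) (𝓝 x) := by
  have han : AnalyticOnNhd ℂ (fun z : ℂ => z ^ n) Set.univ := fun z _ => analyticAt_id.pow n
  rcases han.is_constant_or_isOpenMap with ⟨w, hw⟩ | h
  · have h0 := hw 0
    have h1 := hw 1
    simp only [zero_pow hn, one_pow] at h0 h1
    exact absurd (h1.trans h0.symm) one_ne_zero
  · exact h.nhds_le x

theorem fiftyFour_sub_ne_zero {δ : ℂ} (h : δ ≠ 27 / 4) : 54 - 8 * δ ≠ 0 := by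
  intro h'
  apply h
  linear_combination (-1 / 8 : ℂ) * h'

theorem IsFreeCriticalPt.eventually_exists {δ₀ c : ℂ} (h1 : δ₀ ≠ 27 / 4)
    (hc : IsFreeCriticalPt δ₀ c) {V : Set ℂ} (hV : V ∈ 𝓝 c) :
    ∀ᶠ δ in 𝓝 δ₀, ∃ z ∈ V, IsFreeCriticalPt δ z := by
  obtain ⟨s, hs, hcs⟩ := hc
  have hV' : (fun z : ℂ => z ^ 3) '' V ∈ 𝓝 ((19 * δ₀ + s) / (54 - 8 * δ₀)) := by
    rw [← hcs]
    exact nhds_le_map_pow 3 (by norm_num) c (image_mem_map hV)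
  have hcont : ContinuousAt (fun q : ℂ × ℂ => (19 * q.1 + q.2) / (54 - 8 * q.1)) (δ₀, s) := by
    have := fiftyFour_sub_ne_zero h1
    fun_prop (disch := exact this)
  have hpre := hcont.preimage_mem_nhds hV'
  rw [nhds_prod_eq, mem_prod_iff] at hpre
  obtain ⟨A, hA, S, hS, hAS⟩ := hpre
  have hS' : (fun z : ℂ => z ^ 2) '' S ∈ 𝓝 (27 * (16 * δ₀ + 11 * δ₀ ^ 2)) := by
    rw [← hs]
    exact nhds_le_map_pow 2 (by norm_num) s (image_mem_map hS)
  have hw : ContinuousAt (fun δ : ℂ => 27 * (16 * δ + 11 * δ ^ 2)) δ₀ := by fun_prop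
  filter_upwards [hA, hw.preimage_mem_nhds hS'] with δ hδ hδ'
  obtain ⟨t, ht, hts⟩ := hδ'
  obtain ⟨z, hz, hzt⟩ := hAS (Set.mk_mem_prod hδ ht)
  exact ⟨z, hz, t, hts, hzt⟩

theorem isFreeCriticalPt_iff {δ c : ℂ} (h1 : δ ≠ 27 / 4) :
    IsFreeCriticalPt δ c ↔
      (c ^ 3 * (54 - 8 * δ) - 19 * δ) ^ 2 = 27 * (16 * δ + 11 * δ ^ 2) := by
  have hd := fiftyFour_sub_ne_zero h1
  constructor
  · rintro ⟨s, hs, hc⟩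
    rw [hc, div_mul_cancel₀ _ hd, add_sub_cancel_left, hs]
  · intro h
    exact ⟨_, h, by rw [add_sub_cancel, mul_div_cancel_right₀ _ hd]⟩

theorem IsFreeCriticalPt.eventually_norm_le {δ₀ : ℂ} (h1 : δ₀ ≠ 27 / 4) :
    ∃ R : ℝ, ∀ᶠ δ in 𝓝 δ₀, ∀ c, IsFreeCriticalPt δ c → ‖c‖ ≤ R := by
  set g : ℂ → ℝ := fun δ => (19 * ‖δ‖ + (1 + ‖27 * (16 * δ + 11 * δ ^ 2)‖)) / ‖54 - 8 * δ‖
    with hg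
  have hd := fiftyFour_sub_ne_zero h1
  have hgc : ContinuousAt g δ₀ := by
    have := norm_ne_zero_iff.2 hd
    fun_prop (disch := exact this)
  -- Beyond this radius ‖c‖ ≥ 1, hence ‖c‖ ≤ ‖c‖^3 ≤ g δ < g δ₀ + 1, a contradiction.
  refine ⟨1 + (g δ₀ + 1), ?_⟩
  filter_upwards [hgc.eventually (gt_mem_nhds (lt_add_one _))] with δ hδ c hc
  obtain ⟨s, hs, hcs⟩ := hc
  have hsn : ‖s‖ ≤ 1 + ‖27 * (16 * δ + 11 * δ ^ 2)‖ := by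
    rw [← hs, norm_pow]
    nlinarith [sq_nonneg (‖s‖ - 1)]
  have h3 : ‖c‖ ^ 3 ≤ g δ := by
    rw [← norm_pow, hcs, norm_div, hg]
    simp only
    gcongr
    refine (norm_add_le _ _).trans ?_
    rw [norm_mul]
    have h19 : ‖(19 : ℂ)‖ = 19 := by norm_num
    rw [h19]
    gcongr
  by_contra! hlt
  have hg0 : 0 ≤ g δ := by positivity
  have : 1 ≤ ‖c‖ := by linarith
  nlinarith [pow_le_pow_right₀ this (show 1 ≤ 3 by norm_num)]

/-! ### Parameters whose free critical points converge to roots -/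

/-- The parameters `δ ∉ {0, 27/4}` for which every free critical point lies in the basin of a cube
root of unity. -/
def rootParameters : Set ℂ :=
  {δ | δ ≠ 0 ∧ δ ≠ 27 / 4 ∧ ∀ c : ℂ, IsFreeCriticalPt δ c →
    ∃ ξ : ℂ, ξ ^ 3 = 1 ∧ (c : OnePoint ℂ) ∈ basin (cubicTraub δ) (ξ : OnePoint ℂ)}

theorem rootParameters_subset : rootParameters ⊆ hyperbolicParameters := by
  rintro δ ⟨h0, h1, h⟩
  refine ⟨h0, h1, fun c hc => ?_⟩
  obtain ⟨ξ, hξ, hb⟩ := h c hc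
  exact ⟨1, ξ, isAttractingPeriodicPt_root hξ δ, hb⟩

theorem eventually_mem_basin_of_iterate {δ₀ : ℂ} (h0 : δ₀ ≠ 0) (h1 : δ₀ ≠ 27 / 4) {ξ : ℂ}
    (hξ : ξ ^ 3 = 1) {x : OnePoint ℂ} (hx : x ∈ basin (cubicTraub δ₀) (ξ : OnePoint ℂ)) :
    ∀ᶠ q : ℂ × OnePoint ℂ in 𝓝 (δ₀, x),
      q.2 ∈ basin (cubicTraub q.1) (ξ : OnePoint ℂ) := by
  have hx' : Tendsto (fun n => (cubicTraub δ₀)^[n] x) atTop (𝓝 (ξ : OnePoint ℂ)) := hx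
  have hloc := (eventually_mem_basin_root hξ δ₀).eventually_nhds
  have hconst : Tendsto (fun n => (δ₀, (cubicTraub δ₀)^[n] x)) atTop
      (𝓝 (δ₀, (ξ : OnePoint ℂ))) := tendsto_const_nhds.prodMk_nhds hx'
  obtain ⟨n, hn⟩ := (hconst.eventually hloc).exists
  have hc : ContinuousAt (fun q : ℂ × OnePoint ℂ => (q.1, (cubicTraub q.1)^[n] q.2)) (δ₀, x) :=
    continuousAt_fst.prodMk (continuousAt_iterate_cubicTraub h0 h1 n x)
  filter_upwards [hc.eventually hn] with q hq
  exact mem_basin_of_iterate_mem n hq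

/-- Near a pair (δ₀, c), either c is a free critical point and its convergence to a root persists,
or nearby pairs are not critical. Compactness of a disc holding all free critical points gives one
neighbourhood of δ₀. -/
theorem isOpen_rootParameters : IsOpen rootParameters := by
  rw [isOpen_iff_eventually]
  rintro δ₀ ⟨h0, h1, h⟩
  obtain ⟨R, hR⟩ := IsFreeCriticalPt.eventually_norm_le h1
  have key : ∀ c ∈ Metric.closedBall (0 : ℂ) R, ∀ᶠ q : ℂ × ℂ in 𝓝 (δ₀, c),
      IsFreeCriticalPt q.1 q.2 → ∃ ξ : ℂ, ξ ^ 3 = 1 ∧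
        (q.2 : OnePoint ℂ) ∈ basin (cubicTraub q.1) (ξ : OnePoint ℂ) := by
    intro c _
    by_cases hc : IsFreeCriticalPt δ₀ c
    · obtain ⟨ξ, hξ, hb⟩ := h c hc
      have hcont : ContinuousAt (fun q : ℂ × ℂ => (q.1, (q.2 : OnePoint ℂ))) (δ₀, c) :=
        continuousAt_fst.prodMk (OnePoint.continuous_coe.continuousAt.comp continuousAt_snd)
      filter_upwards [hcont.eventually (eventually_mem_basin_of_iterate h0 h1 hξ hb)] with q hq _
      exact ⟨ξ, hξ, hq⟩
    · rw [isFreeCriticalPt_iff h1] at hc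
      have hcont : ContinuousAt (fun q : ℂ × ℂ => (q.2 ^ 3 * (54 - 8 * q.1) - 19 * q.1) ^ 2
        - 27 * (16 * q.1 + 11 * q.1 ^ 2)) (δ₀, c) := by fun_prop
      have hfst : ContinuousAt (fun q : ℂ × ℂ => q.1) (δ₀, c) := continuousAt_fst
      filter_upwards [hcont.eventually_ne (sub_ne_zero.2 hc), hfst.eventually_ne h1] with q hq hq1 hf
      exact absurd (sub_eq_zero.2 ((isFreeCriticalPt_iff hq1).1 hf)) hq
  filter_upwards [hR, eventually_ne_nhds h0, eventually_ne_nhds h1,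
    (isCompact_closedBall (0 : ℂ) R).eventually_forall_of_forall_eventually
      (P := fun δ c => IsFreeCriticalPt δ c → ∃ ξ : ℂ, ξ ^ 3 = 1 ∧
        (c : OnePoint ℂ) ∈ basin (cubicTraub δ) (ξ : OnePoint ℂ)) key] with δ hR' h0' h1' hδ
  exact ⟨h0', h1', fun c hc => hδ c (mem_closedBall_zero_iff.2 (hR' c hc)) hc⟩

theorem finite_cubeRoots : {ξ : ℂ | ξ ^ 3 = 1}.Finite := by
  have h : (Polynomial.X ^ 3 - 1 : Polynomial ℂ) ≠ 0 :=
    (Polynomial.monic_X_pow_sub_C (1 : ℂ) (by norm_num : 3 ≠ 0)).ne_zero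
  refine ((Polynomial.X ^ 3 - 1 : Polynomial ℂ).roots.toFinset.finite_toSet).subset ?_
  intro ξ hξ
  have hξ' : ξ ^ 3 = 1 := hξ
  simp [h, hξ']

theorem closure_rootParameters_inter_subset :
    closure rootParameters ∩ hyperbolicParameters ⊆ rootParameters := by
  rintro δ₀ ⟨hcl, h0, h1, hyp⟩
  refine ⟨h0, h1, fun c hc => ?_⟩
  obtain ⟨n, p, ⟨hn, hp, l, hml, hl⟩, hb⟩ := hyp c hc
  have hb' : Tendsto (fun k => ((cubicTraub δ₀)^[n])^[k] (c : OnePoint ℂ)) atTop (𝓝 p) := hb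
  by_cases hroot : ∃ ξ : ℂ, ξ ^ 3 = 1 ∧ (ξ : OnePoint ℂ) = p
  · obtain ⟨ξ, hξ, rfl⟩ := hroot
    refine ⟨ξ, hξ, ?_⟩
    have hconst : Tendsto (fun k => (δ₀, ((cubicTraub δ₀)^[n])^[k] (c : OnePoint ℂ))) atTop
      (𝓝 (δ₀, (ξ : OnePoint ℂ))) := tendsto_const_nhds.prodMk_nhds hb'
    obtain ⟨k, hk⟩ := (hconst.eventually (eventually_mem_basin_root hξ δ₀)).exists
    rw [← Function.iterate_mul] at hk
    exact mem_basin_of_iterate_mem _ hk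
  · exfalso
    push Not at hroot
    have hW : ((fun z : ℂ => (z : OnePoint ℂ)) '' {ξ : ℂ | ξ ^ 3 = 1})ᶜ ∈ 𝓝 p := by
      refine (finite_cubeRoots.image _).isClosed.isOpen_compl.mem_nhds ?_
      rintro ⟨ξ, hξ, h⟩
      exact hroot ξ hξ h
    obtain ⟨D, hD, hDc, hDW, htrap⟩ := exists_trapping_nhds
      (G := fun q => (cubicTraub q.1)^[n] q.2) (continuousAt_iterate_cubicTraub h0 h1 n) hp hml hl
      hW
    obtain ⟨k, hk⟩ := (hb'.eventually (eventually_mem_nhds_iff.2 hD)).exists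
    rw [← Function.iterate_mul] at hk
    have hent := (continuousAt_prod_coe_iff.1
      (continuousAt_iterate_cubicTraub h0 h1 (n * k) c)).preimage_mem_nhds hk
    rw [nhds_prod_eq, mem_prod_iff] at hent
    obtain ⟨A, hA, V, hV, hAV⟩ := hent
    -- A parameter of B near δ₀ whose free critical point z near c enters the trap D; its orbit must
    -- converge to a root, yet it returns to the closed set D, free of roots, at every n-th step.
    obtain ⟨δ, ⟨-, -, hδ⟩, hδA, hδt, z, hzV, hz⟩ :=
      ((mem_closure_iff_frequently.1 hcl).and_eventually ((show ∀ᶠ δ in 𝓝 δ₀, δ ∈ A from hA).and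
        (htrap.and (hc.eventually_exists h1 hV)))).exists
    obtain ⟨ξ, hξ, hzb⟩ := hδ z hz
    have hin : ∀ j : ℕ, (cubicTraub δ)^[n * (k + j)] (z : OnePoint ℂ) ∈ D := by
      intro j
      induction j with
      | zero => exact hAV (Set.mk_mem_prod hδA hzV)
      | succ j ih =>
        rw [← add_assoc, mul_add, mul_one, add_comm, Function.iterate_add_apply]
        exact hδt _ ih
    have hsub : Tendsto (fun j : ℕ => n * (k + j)) atTop atTop :=
      tendsto_atTop_mono (fun j => (Nat.le_add_left j k).trans (Nat.le_mul_of_pos_left _ hn)) tendsto_id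
    have hlim : Tendsto (fun m : ℕ => (cubicTraub δ)^[m] (z : OnePoint ℂ)) atTop
      (𝓝 (ξ : OnePoint ℂ)) := hzb
    have hmem := hDc.mem_of_tendsto (hlim.comp hsub) (Eventually.of_forall hin)
    exact hDW hmem ⟨ξ, hξ, rfl⟩

/-! ### Real parameters -/

/-- The restriction of the Traub map to the real line, off its pole. -/
noncomputable def realTraub (δ x : ℝ) : ℝ :=
  ((54 - 8 * δ) * x ^ 9 + (27 + 15 * δ) * x ^ 6 - 6 * δ * x ^ 3 - δ) / (81 * x ^ 8)

theorem cubicTraub_mul_ofReal {ξ : ℂ} (hξ : ξ ^ 3 = 1) (δ : ℝ) {x : ℝ} (hx : x ≠ 0) :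
    cubicTraub (δ : ℂ) ((ξ * (x : ℂ) : ℂ) : OnePoint ℂ) =
      ((ξ * (realTraub δ x : ℂ) : ℂ) : OnePoint ℂ) := by
  have h0 := ne_zero_of_cube_eq_one hξ
  have hx' : (x : ℂ) ≠ 0 := by exact_mod_cast hx
  rw [cubicTraub_coe _ (mul_ne_zero h0 hx')]
  congr 1
  have h6 : ξ ^ 6 = 1 := by rw [show 6 = 3 * 2 by norm_num, pow_mul, hξ, one_pow]
  have h9 : ξ ^ 9 = 1 := by rw [show 9 = 3 * 3 by norm_num, pow_mul, hξ, one_pow]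
  have h8 : ξ ^ 8 * ξ = 1 := by rw [← pow_succ, h9]
  rw [realTraub]
  push_cast
  simp only [mul_pow, hξ, h6, h9, one_mul]
  rw [← mul_div_assoc, div_eq_div_iff (by simp [h0, hx']) (by simp [hx'])]
  linear_combination (-(((54 - 8 * (δ : ℂ)) * x ^ 9 + (27 + 15 * δ) * x ^ 6 - 6 * δ * x ^ 3 - δ)
    * 81 * x ^ 8)) * h8

theorem realTraub_eq (δ : ℝ) {x : ℝ} (hx : x ≠ 0) :
    realTraub δ x = 1 + (x - 1) ^ 2 * (2 * x + 1) / (3 * x ^ 2) *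
      (1 - δ * (4 * x ^ 6 + 6 * x ^ 5 + 9 * x ^ 4 + 4 * x ^ 3 + 3 * x ^ 2 + 1) / (27 * x ^ 6)) := by
  rw [realTraub]
  field_simp
  ring

theorem realTraub_sub_one_bounds {δ x : ℝ} (h0 : 0 < δ) (h1 : δ ≤ 1) (hx : 1 ≤ x) :
    0 ≤ realTraub δ x - 1 ∧ realTraub δ x - 1 ≤ 2 / 3 * (x - 1) := by
  have hx0 : 0 < x := by linarith
  set P := 4 * x ^ 6 + 6 * x ^ 5 + 9 * x ^ 4 + 4 * x ^ 3 + 3 * x ^ 2 + 1 with hP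
  have hP0 : 0 < P := by positivity
  -- The coefficients of P sum to 27.
  have hP1 : P ≤ 27 * x ^ 6 := by
    have e5 := pow_le_pow_right₀ hx (show 5 ≤ 6 by norm_num)
    have e4 := pow_le_pow_right₀ hx (show 4 ≤ 6 by norm_num)
    have e3 := pow_le_pow_right₀ hx (show 3 ≤ 6 by norm_num)
    have e2 := pow_le_pow_right₀ hx (show 2 ≤ 6 by norm_num)
    have e0 := one_le_pow₀ hx (n := 6)
    rw [hP]
    linarith
  have hb0 : 0 ≤ 1 - δ * P / (27 * x ^ 6) := by
    rw [sub_nonneg, div_le_one (by positivity)]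
    nlinarith
  have hb1 : 1 - δ * P / (27 * x ^ 6) ≤ 1 := by
    rw [sub_le_self_iff]
    positivity
  have ha0 : 0 ≤ (x - 1) ^ 2 * (2 * x + 1) / (3 * x ^ 2) := by positivity
  have ha1 : (x - 1) ^ 2 * (2 * x + 1) / (3 * x ^ 2) ≤ 2 / 3 * (x - 1) := by
    rw [div_le_iff₀ (by positivity)]
    nlinarith [mul_nonneg (sub_nonneg.2 hx) (by linarith : (0 : ℝ) ≤ x + 1)]
  rw [realTraub_eq δ hx0.ne', add_sub_cancel_left]
  exact ⟨mul_nonneg ha0 hb0, (mul_le_of_le_one_right ha0 hb1).trans ha1⟩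

theorem mul_ofReal_mem_basin_of_one_le {δ : ℝ} (h0 : 0 < δ) (h1 : δ ≤ 1) {ξ : ℂ}
    (hξ : ξ ^ 3 = 1) {x : ℝ} (hx : 1 ≤ x) :
    ((ξ * (x : ℂ) : ℂ) : OnePoint ℂ) ∈ basin (cubicTraub (δ : ℂ)) (ξ : OnePoint ℂ) := by
  have hnorm : ∀ y : ℝ, 1 ≤ y → ‖ξ * (y : ℂ) - ξ‖ = ‖ξ‖ * (y - 1) := by
    intro y hy
    rw [show ξ * (y : ℂ) - ξ = ξ * ((y - 1 : ℝ) : ℂ) by push_cast; ring, norm_mul,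
      Complex.norm_of_nonneg (by linarith)]
  refine mem_basin_of_contracting (S := (fun y : ℝ => ξ * (y : ℂ)) '' Set.Ici 1) (k := 2 / 3)
    (by norm_num) (by norm_num) ?_ ⟨x, hx, rfl⟩
  rintro _ ⟨y, hy, rfl⟩
  have hy' : 1 ≤ y := hy
  obtain ⟨hl, hu⟩ := realTraub_sub_one_bounds h0 h1 hy'
  have hl' : 1 ≤ realTraub δ y := by linarith
  refine ⟨_, ⟨realTraub δ y, hl', rfl⟩, cubicTraub_mul_ofReal hξ δ (by linarith), ?_⟩
  simp only [hnorm _ hl', hnorm _ hy']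
  nlinarith [norm_nonneg ξ]

/-- Between the free critical point and `1` the real Traub map takes values at least `1`. -/
theorem one_le_realTraub_of_le_one {δ x : ℝ} (hx0 : 0 < x) (hx1 : x ≤ 1)
    (h : 0 ≤ (54 - 8 * δ) * x ^ 6 - 38 * δ * x ^ 3 - 8 * δ) : 1 ≤ realTraub δ x := by
  rw [realTraub_eq δ hx0.ne', le_add_iff_nonneg_right]
  refine mul_nonneg (by positivity) ?_
  rw [sub_nonneg, div_le_one (by positivity)]
  by_cases hδ : δ ≤ 0
  · exact (mul_nonpos_of_nonpos_of_nonneg hδ (by positivity)).trans (by positivity)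
  push Not at hδ
  -- Half of `h` reads δ(4x^6 + 19x^3 + 4) ≤ 27x^6; the polynomial of the goal exceeds 4x^6 + 19x^3
  -- + 4 by three times this expression.
  have hpoly : 2 * x ^ 5 + 3 * x ^ 4 - 5 * x ^ 3 + x ^ 2 - 1 ≤ 0 := by
    have e : 2 * x ^ 5 + 3 * x ^ 4 - 5 * x ^ 3 + x ^ 2 - 1 =
      -((1 - x) * (x ^ 3 * (2 * x + 5) + (x + 1))) := by ring
    rw [e, neg_nonpos]
    exact mul_nonneg (by linarith) (by positivity)
  nlinarith [mul_nonpos_of_nonneg_of_nonpos hδ.le hpoly]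

/-- The image of the negative free critical point is at least `1`. -/
theorem one_le_realTraub_neg {δ u : ℝ} (hu0 : 0 < u) (hu1 : u < 1) (hδ : 0 < δ)
    (h : (54 - 8 * δ) * u ^ 6 + 38 * δ * u ^ 3 - 8 * δ = 0) : 1 ≤ realTraub δ (-u) := by
  rw [realTraub, le_div_iff₀ (by rw [Even.neg_pow (by decide)]; positivity)]
  -- Modulo the critical equation `h`, the numerator of T(-u) - 1 is 3δ times this product. The
  -- double zero u = 1/2 occurs at δ = 1/4, where the critical point -1/2 maps exactly to 1.
  have hfac : 0 ≤ (2 * u - 1) ^ 2 * (-u ^ 6 - u ^ 5 + 4 * u ^ 4 + 9 * u ^ 3 + 8 * u ^ 2 + 4 * u + 1) := by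
    refine mul_nonneg (sq_nonneg _) ?_
    have e6 : u ^ 6 ≤ 1 := pow_le_one₀ hu0.le hu1.le
    have e5 : u ^ 5 ≤ u := by simpa using pow_le_pow_of_le_one hu0.le hu1.le (show 1 ≤ 5 by norm_num)
    have : 0 ≤ 4 * u ^ 4 + 9 * u ^ 3 + 8 * u ^ 2 := by positivity
    linarith
  have h2 := mul_nonneg hδ.le hfac
  linear_combination 3 * h2 + (u ^ 3 - 1 / 2 + 3 / 2 * u ^ 2) * h

/-! ### The free critical points of real parameters -/

theorem realCbrt_pow (x : ℝ) : realCbrt x ^ 3 = x := by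
  have h : (|x| ^ (1 / 3 : ℝ)) ^ 3 = |x| := by
    rw [← Real.rpow_natCast, ← Real.rpow_mul (abs_nonneg x)]
    norm_num
  rw [realCbrt, mul_pow, h]
  rcases lt_trichotomy x 0 with hx | rfl | hx
  · rw [Real.sign_of_neg hx, abs_of_neg hx]; ring
  · simp
  · rw [Real.sign_of_pos hx, abs_of_pos hx]; ring

/-- In r = z^3 the numerator of T' is, up to a constant, (r - 1) times this quadratic. -/
theorem mul_sq_sub_eq_zero {δ D r : ℝ} (h1 : δ ≤ 1) (hD : D ^ 2 = 27 * (16 * δ + 11 * δ ^ 2))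
    (hr : r = (19 * δ + D) / (54 - 8 * δ)) :
    (54 - 8 * δ) * r ^ 2 - 38 * δ * r - 8 * δ = 0 := by
  have hd : 0 < 54 - 8 * δ := by linarith
  have e : (54 - 8 * δ) * r = 19 * δ + D := by rw [hr]; field_simp
  have : (54 - 8 * δ) * ((54 - 8 * δ) * r ^ 2 - 38 * δ * r - 8 * δ) = 0 := by
    linear_combination ((54 - 8 * δ) * r + 19 * δ + D - 38 * δ) * e + hD
  exact (mul_eq_zero.1 this).resolve_left hd.ne'

section

variable {δ : ℝ}

theorem sq_sqrt_discr (h0 : 0 < δ) :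
    Real.sqrt (27 * (16 * δ + 11 * δ ^ 2)) ^ 2 = 27 * (16 * δ + 11 * δ ^ 2) :=
  Real.sq_sqrt (by positivity)

/-- The difference of squares is 108(1 - δ)(27 - 4δ), with equality at δ = 1, where r_+ = 1. -/
theorem sqrt_discr_le (h1 : δ ≤ 1) :
    Real.sqrt (27 * (16 * δ + 11 * δ ^ 2)) ≤ 54 - 27 * δ := by
  rw [Real.sqrt_le_left (by linarith)]
  nlinarith

theorem lt_sqrt_discr (h0 : 0 < δ) (h1 : δ ≤ 1) :
    19 * δ < Real.sqrt (27 * (16 * δ + 11 * δ ^ 2)) := by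
  refine Real.lt_sqrt_of_sq_lt ?_
  nlinarith

theorem rPlus_pos (h0 : 0 < δ) (h1 : δ ≤ 1) : 0 < rPlus δ := by
  have := lt_sqrt_discr h0 h1
  exact div_pos (by linarith) (by linarith)

theorem rPlus_le_one (h1 : δ ≤ 1) : rPlus δ ≤ 1 := by
  have := sqrt_discr_le h1
  rw [rPlus, div_le_one (by linarith)]
  linarith

theorem rMinus_neg (h0 : 0 < δ) (h1 : δ ≤ 1) : rMinus δ < 0 := by
  have := lt_sqrt_discr h0 h1
  exact div_neg_of_neg_of_pos (by linarith) (by linarith)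

theorem neg_one_lt_rMinus (h0 : 0 < δ) (h1 : δ ≤ 1) : -1 < rMinus δ := by
  have := sqrt_discr_le h1
  rw [rMinus, lt_div_iff₀ (by linarith)]
  linarith

theorem rPlus_quadratic (h0 : 0 < δ) (h1 : δ ≤ 1) :
    (54 - 8 * δ) * rPlus δ ^ 2 - 38 * δ * rPlus δ - 8 * δ = 0 :=
  mul_sq_sub_eq_zero h1 (sq_sqrt_discr h0) rfl

theorem rMinus_quadratic (h0 : 0 < δ) (h1 : δ ≤ 1) :
    (54 - 8 * δ) * rMinus δ ^ 2 - 38 * δ * rMinus δ - 8 * δ = 0 :=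
  mul_sq_sub_eq_zero h1 (D := -Real.sqrt (27 * (16 * δ + 11 * δ ^ 2)))
    (by rw [neg_sq, sq_sqrt_discr h0]) (by rw [rMinus, sub_eq_add_neg])

theorem realCbrt_rPlus_pos (h0 : 0 < δ) (h1 : δ ≤ 1) : 0 < realCbrt (rPlus δ) := by
  rw [← Odd.pow_pos_iff (n := 3) (by decide), realCbrt_pow]
  exact rPlus_pos h0 h1

theorem mul_ofReal_mem_basin {ξ : ℂ} (h0 : 0 < δ) (h1 : δ ≤ 1) (hξ : ξ ^ 3 = 1) {x : ℝ}
    (hx : realCbrt (rPlus δ) ≤ x) :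
    ((ξ * (x : ℂ) : ℂ) : OnePoint ℂ) ∈ basin (cubicTraub (δ : ℂ)) (ξ : OnePoint ℂ) := by
  have hc := realCbrt_rPlus_pos h0 h1
  rcases le_or_gt 1 x with hx1 | hx1
  · exact mul_ofReal_mem_basin_of_one_le h0 h1 hξ hx1
  · have hx0 : 0 < x := hc.trans_le hx
    refine mem_basin_of_iterate_mem 1 ?_
    rw [Function.iterate_one, cubicTraub_mul_ofReal hξ δ hx0.ne']
    refine mul_ofReal_mem_basin_of_one_le h0 h1 hξ (one_le_realTraub_of_le_one hx0 hx1.le ?_)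
    have hr : rPlus δ ≤ x ^ 3 := by
      rw [← realCbrt_pow (rPlus δ)]
      gcongr
    have hr0 := rPlus_pos h0 h1
    have hq := rPlus_quadratic h0 h1
    -- The quadratic at x^3 minus its value at r_+ is (x^3 - r_+) times this factor; by the equation
    -- for r_+, (54 - 8δ) r_+ - 38δ = 8δ/r_+ > 0.
    have hsum : 0 ≤ (54 - 8 * δ) * (x ^ 3 + rPlus δ) - 38 * δ := by
      have : 38 * δ ≤ (54 - 8 * δ) * rPlus δ := by
        refine le_of_mul_le_mul_right ?_ hr0
        nlinarith
      nlinarith [mul_nonneg (by linarith : 0 ≤ 54 - 8 * δ) (hr0.le.trans hr)]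
    nlinarith [mul_nonneg (sub_nonneg.2 hr) hsum]

theorem mul_ofReal_mem_immediateBasin {ξ : ℂ} (h0 : 0 < δ) (h1 : δ ≤ 1) (hξ : ξ ^ 3 = 1) {x : ℝ}
    (hx : realCbrt (rPlus δ) ≤ x) :
    ((ξ * (x : ℂ) : ℂ) : OnePoint ℂ) ∈ immediateBasin (cubicTraub (δ : ℂ)) (ξ : OnePoint ℂ) := by
  have hcont : Continuous (fun y : ℝ => ((ξ * (y : ℂ) : ℂ) : OnePoint ℂ)) :=
    OnePoint.continuous_coe.comp (by fun_prop)
  have hpre : IsPreconnected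
      ((fun y : ℝ => ((ξ * (y : ℂ) : ℂ) : OnePoint ℂ)) '' Set.Ici (realCbrt (rPlus δ))) :=
    isPreconnected_Ici.image _ hcont.continuousOn
  have hone : realCbrt (rPlus δ) ≤ 1 := by
    refine le_of_pow_le_pow_left₀ (n := 3) (by norm_num) zero_le_one ?_
    rw [realCbrt_pow, one_pow]
    exact rPlus_le_one h1
  refine hpre.subset_connectedComponentIn ⟨1, hone, by simp⟩ ?_ ⟨x, hx, rfl⟩
  rintro _ ⟨y, hy, rfl⟩
  exact mul_ofReal_mem_basin h0 h1 hξ hy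

theorem cPlus_mem_immediateBasin {ξ : ℂ} (h0 : 0 < δ) (h1 : δ ≤ 1) (hξ : ξ ^ 3 = 1) :
    ((cPlus δ ξ : ℂ) : OnePoint ℂ) ∈ immediateBasin (cubicTraub (δ : ℂ)) (ξ : OnePoint ℂ) :=
  mul_ofReal_mem_immediateBasin h0 h1 hξ le_rfl

theorem cubicTraub_cMinus_mem_immediateBasin {ξ : ℂ} (h0 : 0 < δ) (h1 : δ ≤ 1) (hξ : ξ ^ 3 = 1) :
    cubicTraub (δ : ℂ) ((cMinus δ ξ : ℂ) : OnePoint ℂ) ∈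
      immediateBasin (cubicTraub (δ : ℂ)) (ξ : OnePoint ℂ) := by
  set u := -realCbrt (rMinus δ) with hu
  have hu3 : u ^ 3 = -rMinus δ := by rw [hu, Odd.neg_pow (by decide), realCbrt_pow]
  have hu0 : 0 < u := by
    rw [← Odd.pow_pos_iff (n := 3) (by decide), hu3]
    linarith [rMinus_neg h0 h1]
  have hu1 : u < 1 := by
    refine lt_of_pow_lt_pow_left₀ 3 zero_le_one ?_
    rw [hu3, one_pow]
    linarith [neg_one_lt_rMinus h0 h1]
  have hc : realCbrt (rMinus δ) = -u := by rw [hu, neg_neg]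
  rw [cMinus, hc, cubicTraub_mul_ofReal hξ δ (neg_ne_zero.2 hu0.ne')]
  have hT : 1 ≤ realTraub δ (-u) := by
    refine one_le_realTraub_neg hu0 hu1 h0 ?_
    rw [show u ^ 6 = (u ^ 3) ^ 2 by ring, hu3]
    linarith [rMinus_quadratic h0 h1]
  refine mul_ofReal_mem_immediateBasin h0 h1 hξ (le_trans ?_ hT)
  refine le_of_pow_le_pow_left₀ (n := 3) (by norm_num) zero_le_one ?_
  rw [realCbrt_pow, one_pow]
  exact rPlus_le_one h1

theorem exists_eq_mul_realCbrt {c : ℂ} {r : ℝ} (hr : r ≠ 0) (hc : c ^ 3 = (r : ℂ)) :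
    ∃ ξ : ℂ, ξ ^ 3 = 1 ∧ c = ξ * (realCbrt r : ℂ) := by
  have h3 : (realCbrt r : ℂ) ^ 3 = (r : ℂ) := by exact_mod_cast realCbrt_pow r
  have hr' : (r : ℂ) ≠ 0 := by exact_mod_cast hr
  have h0 : (realCbrt r : ℂ) ≠ 0 := by
    intro h
    rw [h] at h3
    exact hr' (by simpa using h3.symm)
  exact ⟨c / realCbrt r, by rw [div_pow, hc, h3, div_self hr'], (div_mul_cancel₀ _ h0).symm⟩

theorem IsFreeCriticalPt.exists_eq {c : ℂ} (h0 : 0 < δ) (h1 : δ ≤ 1)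
    (hc : IsFreeCriticalPt (δ : ℂ) c) : ∃ ξ : ℂ, ξ ^ 3 = 1 ∧ (c = cPlus δ ξ ∨ c = cMinus δ ξ) := by
  obtain ⟨s, hs, hcs⟩ := hc
  have hD : ((Real.sqrt (27 * (16 * δ + 11 * δ ^ 2)) : ℝ) : ℂ) ^ 2 =
      27 * (16 * δ + 11 * δ ^ 2) := by exact_mod_cast sq_sqrt_discr h0
  rcases sq_eq_sq_iff_eq_or_eq_neg.1 (hs.trans hD.symm) with rfl | rfl
  · obtain ⟨ξ, hξ, h⟩ := exists_eq_mul_realCbrt (rPlus_pos h0 h1).ne' (c := c)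
      (by rw [hcs, rPlus]; push_cast; rfl)
    exact ⟨ξ, hξ, Or.inl h⟩
  · obtain ⟨ξ, hξ, h⟩ := exists_eq_mul_realCbrt (rMinus_neg h0 h1).ne (c := c)
      (by rw [hcs, rMinus]; push_cast; ring)
    exact ⟨ξ, hξ, Or.inr h⟩

theorem ofReal_mem_rootParameters (h0 : 0 < δ) (h1 : δ ≤ 1) : (δ : ℂ) ∈ rootParameters := by
  refine ⟨by exact_mod_cast h0.ne', ?_, fun c hc => ?_⟩
  · intro h
    have h' : δ = 27 / 4 := Complex.ofReal_injective (by rw [h]; push_cast; rfl)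
    linarith
  · obtain ⟨ξ, hξ, rfl | rfl⟩ := hc.exists_eq h0 h1
    · exact ⟨ξ, hξ, connectedComponentIn_subset _ _ (cPlus_mem_immediateBasin h0 h1 hξ)⟩
    · exact ⟨ξ, hξ, mem_basin_of_iterate_mem 1
        (connectedComponentIn_subset _ _ (cubicTraub_cMinus_mem_immediateBasin h0 h1 hξ))⟩

end

theorem mainTheorem4 :
    (∀ δ : ℝ, 0 < δ → δ ≤ 1 → ∀ ξ : ℂ, ξ ^ 3 = 1 →
      ((cPlus δ ξ : ℂ) : OnePoint ℂ) ∈ immediateBasin (cubicTraub (δ : ℂ)) (ξ : OnePoint ℂ) ∧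
      cubicTraub (δ : ℂ) ((cMinus δ ξ : ℂ) : OnePoint ℂ) ∈
        immediateBasin (cubicTraub (δ : ℂ)) (ξ : OnePoint ℂ)) ∧
    ∃ U : Set ℂ, IsHyperbolicComponent U ∧
      (∀ δ : ℝ, 0 < δ → δ ≤ 1 → (δ : ℂ) ∈ U) ∧
      ∀ δ ∈ U, ∀ c : ℂ, IsFreeCriticalPt δ c →
        ∃ ξ : ℂ, ξ ^ 3 = 1 ∧ (c : OnePoint ℂ) ∈ basin (cubicTraub δ) (ξ : OnePoint ℂ) := by
  refine ⟨fun δ h0 h1 ξ hξ => ⟨cPlus_mem_immediateBasin h0 h1 hξ,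
    cubicTraub_cMinus_mem_immediateBasin h0 h1 hξ⟩, ?_⟩
  have h1B : (1 : ℂ) ∈ rootParameters := by
    simpa using ofReal_mem_rootParameters (δ := 1) one_pos le_rfl
  have h1H := rootParameters_subset h1B
  set U := connectedComponentIn hyperbolicParameters (1 : ℂ) with hU
  have h1U : (1 : ℂ) ∈ U := mem_connectedComponentIn h1H
  have hUB : U ⊆ rootParameters :=
    isPreconnected_connectedComponentIn.subset_of_closure_inter_subset isOpen_rootParameters
      ⟨1, h1U, h1B⟩ fun δ hδ => closure_rootParameters_inter_subset
        ⟨hδ.1, connectedComponentIn_subset _ _ hδ.2⟩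
  -- Openness of U comes from B: U is also a component of the open set B, and ℂ is locally
  -- connected.
  have hUeq : U = connectedComponentIn rootParameters 1 :=
    (isPreconnected_connectedComponentIn.subset_connectedComponentIn h1U hUB).antisymm
      (connectedComponentIn_mono _ rootParameters_subset)
  refine ⟨U, ⟨hUeq ▸ isOpen_rootParameters.connectedComponentIn, 1, h1H, rfl⟩, ?_, fun δ hδ c hc => ?_⟩
  · intro δ h0 h1
    have hpre : IsPreconnected ((fun x : ℝ => (x : ℂ)) '' Set.Ioc 0 1) :=
      isPreconnected_Ioc.image _ Complex.continuous_ofReal.continuousOn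
    refine hpre.subset_connectedComponentIn ⟨1, ⟨one_pos, le_rfl⟩, by simp⟩ ?_ ⟨δ, ⟨h0, h1⟩, rfl⟩
    rintro _ ⟨x, hx, rfl⟩
    exact rootParameters_subset (ofReal_mem_rootParameters hx.1 hx.2)
  · exact (hUB hδ).2.2 c hc
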